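/- Let $E$ be a finite-dimensional real inner product space (for instance $\mathbb{R}^{d\times r}$ with the Frobenius inner product), with norm $\|\cdot\|$, and let $\mathcal{M}\subset E$ be a nonempty compact smooth ($C^\infty$, embedded) submanifold. For $x\in E$ put $\operatorname{dist}(x,\mathcal{M})=\inf_{y\in\mathcal{M}}\|y-x\|$ and $\mathcal{P}_{\mathcal{M}}(x)=\operatorname{argmin}_{y\in\mathcal{M}}\|y-x\|$. Let $\gamma>0$ be such that $\mathcal{M}$ is $2\gamma$-proximally smooth, i.e. $\mathcal{P}_{\mathcal{M}}(x)$ is a singleton whenever $\operatorname{dist}(x,\mathcal{M})<2\gamma$, and let $\bar U_{\mathcal{M}}(\gamma)=\{x\in E:\operatorname{dist}(x,\mathcal{M})\le\gamma\}$. Then $\mathcal{P}_{\mathcal{M}}$ is smooth at every point of $\bar U_{\mathcal{M}}(\gamma)$, the maximum $$M_2=\max_{x\in \operatorname{conv}(\mathcal{M})\cap\bar U_{\mathcal{M}}(\gamma)}\|D^2\mathcal{P}_{\mathcal{M}}(x)\|_{\rm op}$$ exists (and is finite), and the following holds. For every integer $n\ge 1$ and every $\mathbf{x}=(x_1,\dots,x_n)\in\mathcal{M}^n$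 with Euclidean mean $\hat x=\frac1n\sum_{i=1}^n x_i$, and every $\bar x\in\mathcal{P}_{\mathcal{M}}(\hat x)$ such that $\|x_i-\bar x\|\le\gamma$ for all $i$, $$\|\bar x-\hat x\|\le M_2\,\frac{\|\mathbf{x}-\bar{\mathbf{x}}\|^2}{n},$$ where $\bar{\mathbf{x}}=(\bar x,\dots,\bar x)$ and $\|\mathbf{x}-\bar{\mathbf{x}}\|^2=\sum_{i=1}^n\|x_i-\bar x\|^2$. -/

import Mathlib

open scoped ContDiff

noncomputable section

variable {E : Type*} [NormedAddCommGroup E] [InnerProductSpace ℝ E]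

/-- `M` is a smooth (embedded) submanifold of codimension `c` of the Euclidean space `E`:
around each of its points, `M` is the zero set of a smooth map to `ℝᶜ` whose differential
at that point has full rank. -/
def IsSmoothSubmanifold (c : ℕ) (M : Set E) : Prop :=
  ∀ p ∈ M, ∃ U : Set E, IsOpen U ∧ p ∈ U ∧
    ∃ h : E → EuclideanSpace ℝ (Fin c),
      ContDiffOn ℝ ∞ h U ∧ Function.Surjective (fderiv ℝ h p) ∧ M ∩ U = {y ∈ U | h y = 0}

/-- The (set-valued) nearest-point projection, `argmin_{y ∈ M} ‖y - x‖`. -/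
def projSet (M : Set E) (x : E) : Set E :=
  {y | y ∈ M ∧ ∀ z ∈ M, ‖y - x‖ ≤ ‖z - x‖}

/-- The projection as a map: some nearest point of `M` to `x` (the nearest point, where it is
unique). -/
def proj (M : Set E) (x : E) : E :=
  Classical.epsilon fun y => y ∈ projSet M x

/-- `M` is closed, and every point at distance less than `R` from `M` has exactly one nearest
point in `M`. -/
def IsProximallySmooth (R : ℝ) (M : Set E) : Prop :=
  IsClosed M ∧ ∀ x : E, Metric.infDist x M < R → ∃ y, projSet M x = {y}

/-- The closed tube `{x : dist(x, M) ≤ r}`. -/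
def closedTube (M : Set E) (r : ℝ) : Set E :=
  {x | Metric.infDist x M ≤ r}

/-- The operator norm of the second derivative of the projection at `x`, that is, of the
bilinear map `D²P_M(x)` from `E × E` to `E`. -/
def projSecondDerivNorm (M : Set E) (x : E) : ℝ :=
  ‖fderiv ℝ (fderiv ℝ (proj M)) x‖

/-- The Euclidean mean `(1/n) ∑ᵢ xᵢ`. -/
def euclideanMean {n : ℕ} (x : PiLp 2 fun _ : Fin n => E) : E :=
  (n : ℝ)⁻¹ • ∑ i, x i

/-- The stacked vector `(y, …, y)`, an element of `Eⁿ` with its Euclidean norm. -/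
def stack (n : ℕ) (y : E) : PiLp 2 fun _ : Fin n => E :=
  WithLp.toLp 2 fun _ => y

end

open Filter Topology Metric Set

set_option linter.unusedSectionVars false

/-! ### Nearest points under proximal smoothness. -/

section
variable {E : Type*} [NormedAddCommGroup E] [InnerProductSpace ℝ E]

/-! Write `P` for the projection. It fixes `M`, so `x i - xbar = P (x i) - P xbar`, and a Taylor
bound on the segment, which lies in the convex hull and in the tube, compares this with `DP(xbar) (x
i - xbar)` up to `M₂ * ‖x i - xbar‖ ^ 2`. Averaging over `i` kills the linear terms: `P` is constant
from `xbar` towards the mean, so `DP(xbar)` annihilates their difference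
(`fderiv_proj_apply_eq_zero`).

The main work is smoothness of `P` (`contDiffAt_proj`). The inverse function theorem is applied to
the Lagrange system for the squared distance. Its nondegeneracy holds because the nearest point `p`
of `x` stays nearest for some point strictly beyond `x` on the ray from `p`
(`exists_one_lt_mem_projSet`), which makes the second-order condition at `x` strict. `M₂` then
exists by compactness of the convex hull. -/

theorem mem_projSet_iff {M : Set E} (hne : M.Nonempty) {x y : E} :
    y ∈ projSet M x ↔ y ∈ M ∧ ‖y - x‖ = infDist x M := by
  constructor
  · rintro ⟨hy, h⟩
    refine ⟨hy, le_antisymm ?_ ?_⟩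
    · refine (le_infDist hne).2 fun z hz => ?_
      rw [dist_eq_norm, norm_sub_rev x z]
      exact h z hz
    · rw [norm_sub_rev, ← dist_eq_norm]
      exact infDist_le_dist_of_mem hy
  · rintro ⟨hy, h⟩
    refine ⟨hy, fun z hz => ?_⟩
    rw [h, norm_sub_rev, ← dist_eq_norm]
    exact infDist_le_dist_of_mem hz

theorem projSet_nonempty {M : Set E} (hne : M.Nonempty) (hc : IsCompact M) (x : E) :
    (projSet M x).Nonempty := by
  obtain ⟨y, hy, h⟩ := hc.exists_infDist_eq_dist hne x
  exact ⟨y, (mem_projSet_iff hne).2 ⟨hy, by rw [h, norm_sub_rev, dist_eq_norm]⟩⟩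

theorem proj_mem_projSet {M : Set E} (hne : M.Nonempty) (hc : IsCompact M) (x : E) :
    proj M x ∈ projSet M x :=
  Classical.epsilon_spec (projSet_nonempty hne hc x)

theorem proj_mem {M : Set E} (hne : M.Nonempty) (hc : IsCompact M) (x : E) : proj M x ∈ M :=
  (proj_mem_projSet hne hc x).1

theorem norm_proj_sub {M : Set E} (hne : M.Nonempty) (hc : IsCompact M) (x : E) :
    ‖proj M x - x‖ = infDist x M :=
  ((mem_projSet_iff hne).1 (proj_mem_projSet hne hc x)).2

theorem proj_eq_of_mem_projSet {M : Set E} {R : ℝ} (hprox : IsProximallySmooth R M) {x y : E}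
    (hx : infDist x M < R) (hy : y ∈ projSet M x) : proj M x = y := by
  obtain ⟨z, hz⟩ := hprox.2 x hx
  have h : proj M x ∈ projSet M x := Classical.epsilon_spec (p := fun y => y ∈ projSet M x) ⟨y, hy⟩
  rw [hz] at h hy
  exact h.trans hy.symm

theorem proj_of_mem {M : Set E} {R : ℝ} (hR : 0 < R) (hprox : IsProximallySmooth R M) {x : E}
    (hx : x ∈ M) : proj M x = x :=
  proj_eq_of_mem_projSet hprox (by rwa [infDist_zero_of_mem hx]) ⟨hx, by simp⟩

/-- A nearest point to `x` stays a nearest point along the segment to `x`. -/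
theorem mem_projSet_segment {M : Set E} {x p : E} (hp : p ∈ projSet M x) {s : ℝ} (h0 : 0 ≤ s)
    (h1 : s ≤ 1) : p ∈ projSet M (p + s • (x - p)) := by
  refine ⟨hp.1, fun z hz => ?_⟩
  have e1 : ‖p - (p + s • (x - p))‖ = s * ‖p - x‖ := by
    rw [sub_add_cancel_left, norm_neg, norm_smul, Real.norm_of_nonneg h0, norm_sub_rev]
  have e2 : ‖(p + s • (x - p)) - x‖ = (1 - s) * ‖p - x‖ := by
    rw [show p + s • (x - p) - x = (1 - s) • (p - x) by module, norm_smul,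
      Real.norm_of_nonneg (by linarith)]
  have := norm_sub_le_norm_sub_add_norm_sub z (p + s • (x - p)) x
  have := hp.2 z hz
  linarith

/-- By compactness it suffices that each cluster point is a nearest point of `x`, and that one is
unique. -/
theorem tendsto_proj {M : Set E} (hne : M.Nonempty) (hc : IsCompact M) {R : ℝ}
    (hprox : IsProximallySmooth R M) {x : E} (hx : infDist x M < R) :
    Tendsto (proj M) (𝓝 x) (𝓝 (proj M x)) := by
  refine hc.tendsto_nhds_of_unique_mapClusterPt (.of_forall fun z => proj_mem hne hc z) ?_
  intro y hy hcl
  refine (proj_eq_of_mem_projSet hprox hx ((mem_projSet_iff hne).2 ⟨hy, ?_⟩)).symm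
  refine le_antisymm (le_of_forall_pos_le_add fun ε hε => ?_) ?_
  · have h1 : ∀ᶠ w in 𝓝 y, dist w y < ε / 3 := ball_mem_nhds y (by positivity)
    have h2 : ∀ᶠ z in 𝓝 x, dist z x < ε / 3 := ball_mem_nhds x (by positivity)
    obtain ⟨z, hz1, hz2⟩ := ((hcl.frequently h1).and_eventually h2).exists
    have h3 := norm_proj_sub hne hc z
    have h4 : infDist z M ≤ infDist x M + dist z x := infDist_le_infDist_add_dist
    rw [← dist_eq_norm] at h3 ⊢
    have h5 := dist_triangle4 y (proj M z) z x
    rw [dist_comm y (proj M z)] at h5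
    linarith
  · rw [norm_sub_rev, ← dist_eq_norm]
    exact infDist_le_dist_of_mem hy

/-- Moving away from the nearest point increases the distance at a rate arbitrarily close to `1`. -/
theorem exists_infDist_ascent {M : Set E} (hne : M.Nonempty) (hc : IsCompact M) {R : ℝ}
    (hprox : IsProximallySmooth R M) {z : E} (hz : infDist z M < R) (hpos : 0 < infDist z M)
    {η ρ : ℝ} (hη0 : 0 < η) (hη1 : η < 1) (hρ : 0 < ρ) :
    ∃ w, dist w z < ρ ∧ infDist z M + (1 - η) * dist w z < infDist w M := by
  set D := infDist z M with hD
  set u := z - proj M z with hu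
  have hun : ‖u‖ = D := by rw [hu, norm_sub_rev, norm_proj_sub hne hc]
  have hline : Tendsto (fun e : ℝ => z + e • u) (𝓝[>] 0) (𝓝 z) := by
    have : Continuous fun e : ℝ => z + e • u := by fun_prop
    simpa using (this.tendsto 0).mono_left nhdsWithin_le_nhds
  have hin : Tendsto (fun e : ℝ => inner ℝ u (z - proj M (z + e • u))) (𝓝[>] 0) (𝓝 (D ^ 2)) := by
    have h := (tendsto_proj hne hc hprox hz).comp hline
    have h' : Tendsto (fun e : ℝ => inner ℝ u (z - proj M (z + e • u))) (𝓝[>] 0)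
        (𝓝 (inner ℝ u (z - proj M z))) := tendsto_const_nhds.inner (tendsto_const_nhds.sub h)
    rwa [← hu, real_inner_self_eq_norm_sq, hun] at h'
  have hlt : (1 - η) * D ^ 2 < D ^ 2 := by nlinarith [pow_pos hpos 2]
  obtain ⟨e, ⟨he1, he2⟩, he0⟩ := ((hin.eventually_const_lt hlt).and
    (hline.eventually (ball_mem_nhds z hρ)) |>.and self_mem_nhdsWithin).exists
  refine ⟨z + e • u, he2, ?_⟩
  have hdist : dist (z + e • u) z = e * D := by
    rw [dist_eq_norm, add_sub_cancel_left, norm_smul, hun, Real.norm_of_nonneg he0.le]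
  rw [hdist]
  set q := proj M (z + e • u) with hq
  have hqd : infDist (z + e • u) M = ‖(z - q) + e • u‖ := by
    rw [← norm_proj_sub hne hc, ← hq, norm_sub_rev]
    congr 1
    abel
  have hqD : D ≤ ‖z - q‖ := by
    rw [← dist_eq_norm]
    exact infDist_le_dist_of_mem (proj_mem hne hc _)
  rw [hqd]
  -- After squaring, the cross term `2 * e * ⟪u, z - q⟫` exceeds `2 * e * (1 - η) * D ^ 2`, by
  -- continuity of the projection at `z`.
  refine lt_of_pow_lt_pow_left₀ 2 (norm_nonneg _) ?_
  rw [norm_add_sq_real, inner_smul_right, real_inner_comm, norm_smul, hun,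
    Real.norm_of_nonneg he0.le]
  have h1 : D ^ 2 ≤ ‖z - q‖ ^ 2 := by gcongr
  have h2 : e * ((1 - η) * D ^ 2) < e * inner ℝ u (z - q) := by gcongr
  have h3 : (1 - η) ^ 2 ≤ 1 := by nlinarith
  have h4 : (1 - η) ^ 2 * (e * D) ^ 2 ≤ (e * D) ^ 2 := mul_le_of_le_one_left (by positivity) h3
  nlinarith

/-- A maximizer over the ball of the distance penalized by `(1 - η) * dist z x` cannot be interior,
by the ascent lemma. On the sphere it gains at least `(1 - η) * s`; then `η` is made small. -/
theorem exists_infDist_add_le [FiniteDimensional ℝ E] {M : Set E} (hne : M.Nonempty)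
    (hc : IsCompact M) {R : ℝ} (hprox : IsProximallySmooth R M) {x : E} (hpos : 0 < infDist x M)
    {s : ℝ} (hs : 0 < s) (hsR : infDist x M + s < R) :
    ∃ z, dist z x ≤ s ∧ infDist x M + s ≤ infDist z M := by
  have hK : IsCompact (closedBall x s) := isCompact_closedBall x s
  have hKne : (closedBall x s).Nonempty := nonempty_closedBall.2 hs.le
  have hcont : Continuous fun z => infDist z M := continuous_infDist_pt M
  obtain ⟨z, hz, hzmax⟩ := hK.exists_isMaxOn hKne hcont.continuousOn
  refine ⟨z, hz, le_of_forall_pos_le_add fun ε hε => ?_⟩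
  obtain ⟨η, hη0, hη1, hηs⟩ : ∃ η : ℝ, 0 < η ∧ η < 1 ∧ η * s ≤ ε :=
    ⟨min (1 / 2) (ε / s), by positivity, (min_le_left _ _).trans_lt (by norm_num),
      (le_div_iff₀ hs).1 (min_le_right _ _)⟩
  obtain ⟨y, hy, hymax⟩ := hK.exists_isMaxOn hKne
    (f := fun z => infDist z M - (1 - η) * dist z x) (by fun_prop)
  have hyx := hymax (mem_closedBall_self hs.le)
  have hyz := hzmax hy
  simp only [mem_ofPred_eq, dist_self, mul_zero, sub_zero] at hyx hyz
  rcases (mem_closedBall.1 hy).lt_or_eq with hlt | heq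
  · exfalso
    have h1 : infDist y M ≤ infDist x M + dist y x := infDist_le_infDist_add_dist
    have h2 : 0 ≤ (1 - η) * dist y x := mul_nonneg (by linarith) dist_nonneg
    obtain ⟨w, hw1, hw2⟩ := exists_infDist_ascent (z := y) hne hc hprox (by linarith)
      (by linarith) hη0 hη1 (sub_pos.2 hlt)
    have h3 := dist_triangle w y x
    have h4 := hymax (mem_closedBall.2 (by linarith : dist w x ≤ s))
    simp only [mem_ofPred_eq] at h4
    nlinarith [mul_le_mul_of_nonneg_left h3 (by linarith : 0 ≤ 1 - η)]
  · rw [heq] at hyx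
    linarith

/-- In a proximally smooth set, a nearest point remains nearest slightly beyond `x`. -/
theorem exists_one_lt_mem_projSet [FiniteDimensional ℝ E] {M : Set E} (hne : M.Nonempty)
    (hc : IsCompact M) {R : ℝ} (hprox : IsProximallySmooth R M) {x p : E}
    (hx : infDist x M < R) (hp : p ∈ projSet M x) :
    ∃ t : ℝ, 1 < t ∧ p ∈ projSet M (p + t • (x - p)) := by
  obtain ⟨hpM, hpd⟩ := (mem_projSet_iff hne).1 hp
  rcases eq_or_ne x p with rfl | hxp
  · exact ⟨2, by norm_num, by simpa using hp⟩
  have hpos : 0 < infDist x M := by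
    rw [← hpd]
    exact norm_pos_iff.2 (sub_ne_zero.2 hxp.symm)
  obtain ⟨s, hs, hsR⟩ : ∃ s : ℝ, 0 < s ∧ infDist x M + s < R :=
    ⟨(R - infDist x M) / 2, by linarith, by linarith⟩
  obtain ⟨z, hzs, hz⟩ := exists_infDist_add_le hne hc hprox hpos hs hsR
  rw [dist_eq_norm] at hzs
  have h1 : infDist z M ≤ ‖(x - p) + (z - x)‖ := by
    rw [show (x - p) + (z - x) = z - p by abel, ← dist_eq_norm]
    exact infDist_le_dist_of_mem hpM
  have h2 := norm_add_le (x - p) (z - x)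
  have h3 : ‖x - p‖ = infDist x M := by rw [norm_sub_rev, hpd]
  -- Equality in the triangle inequality forces `z` onto the ray from `p` through `x`.
  have hray : SameRay ℝ (x - p) (z - x) := sameRay_iff_norm_add.2 (by linarith)
  obtain ⟨r, hr, hrz⟩ := hray.exists_nonneg_left (sub_ne_zero.2 hxp)
  have hr0 : r ≠ 0 := by
    rintro rfl
    rw [zero_smul] at hrz
    rw [← hrz, add_zero] at h1
    linarith
  have hzeq : p + (1 + r) • (x - p) = z := by
    rw [add_smul, one_smul, hrz]
    abel
  refine ⟨1 + r, by linarith [lt_of_le_of_ne hr hr0.symm], ?_⟩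
  rw [hzeq, mem_projSet_iff hne]
  refine ⟨hpM, ?_⟩
  rw [norm_sub_rev, show z - p = (x - p) + (z - x) by abel]
  linarith


/-- By Carathéodory, combinations of at most `finrank + 1` points suffice, so the hull is a finite
union of continuous images of compact sets. -/
theorem isCompact_convexHull [FiniteDimensional ℝ E] {M : Set E} (hM : IsCompact M) :
    IsCompact (convexHull ℝ M) := by
  let C : ℕ → Set E := fun k =>
    (fun a : (Fin k → ℝ) × (Fin k → E) => ∑ i, a.1 i • a.2 i) ''
      (stdSimplex ℝ (Fin k) ×ˢ univ.pi fun _ => M)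
  have hC : ∀ k, IsCompact (C k) := fun k =>
    ((isCompact_stdSimplex ℝ (Fin k)).prod (isCompact_univ_pi fun _ => hM)).image (by fun_prop)
  have heq : convexHull ℝ M = ⋃ k ∈ Finset.range (Module.finrank ℝ E + 2), C k := by
    refine Subset.antisymm (fun x hx => ?_) (iUnion₂_subset fun k _ => ?_)
    · obtain ⟨ι, hι, z, w, hz, hind, hw, hw1, rfl⟩ := eq_pos_convex_span_of_mem_convexHull hx
      have hcard : Fintype.card ι ≤ Module.finrank ℝ E + 1 :=
        hind.card_le_finrank_succ.trans (Nat.succ_le_succ (Submodule.finrank_le _))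
      let e := (Fintype.equivFin ι).symm
      refine mem_iUnion₂.2 ⟨Fintype.card ι, Finset.mem_range.2 (by omega), ⟨(w ∘ e, z ∘ e),
        ⟨⟨fun i => (hw _).le, ?_⟩, fun i _ => hz (mem_range_self _)⟩, ?_⟩⟩
      · exact (e.sum_comp w).trans hw1
      · exact e.sum_comp fun i => w i • z i
    · rintro _ ⟨⟨w, z⟩, ⟨hw, hz⟩, rfl⟩
      exact (convex_convexHull ℝ M).sum_mem (fun i _ => hw.1 i) hw.2
        fun i _ => subset_convexHull ℝ M (hz i (mem_univ i))
  rw [heq]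
  exact (Finset.range _).isCompact_biUnion fun k _ => hC k

end

/-! ### Second-order conditions on level sets. -/

section
variable {E F : Type*} [NormedAddCommGroup E] [NormedSpace ℝ E]
  [NormedAddCommGroup F] [NormedSpace ℝ F] [CompleteSpace F]

/-- Through a point of a level set of a submersion there is a smooth curve in the level set, with
any prescribed velocity in the kernel of the differential. -/
theorem exists_contDiffAt_curve_level {n : WithTop ℕ∞} (hn : n ≠ 0) {h : E → F} {p : E}
    (hh : ContDiffAt ℝ n h p) {B : F →L[ℝ] E}
    (hB : fderiv ℝ h p ∘L B = ContinuousLinearMap.id ℝ F) {v : E} (hv : fderiv ℝ h p v = 0) :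
    ∃ c : ℝ → E, ContDiffAt ℝ n c 0 ∧ c 0 = p ∧ HasDerivAt c v 0 ∧ ∀ᶠ s in 𝓝 0, h (c s) = h p := by
  have hB' : ∀ w, fderiv ℝ h p (B w) = w := fun w => congr($hB w)
  let L : ℝ × F →L[ℝ] E := (ContinuousLinearMap.fst ℝ ℝ F).smulRight v +
    B ∘L ContinuousLinearMap.snd ℝ ℝ F
  have hL : ∀ a, L a = a.1 • v + B a.2 := fun a => rfl
  let G : ℝ × F → F := fun a => h (p + L a)
  have hp0 : p + L ((0, 0) : ℝ × F) = p := by simp [hL]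
  have hG : ContDiffAt ℝ n G (0, 0) := by
    refine ContDiffAt.comp (g := h) (f := fun a => p + L a) _ (by rwa [hp0]) (by fun_prop)
  have hGd : HasFDerivAt G (fderiv ℝ h p ∘L L) ((0, 0) : ℝ × F) := by
    refine HasFDerivAt.comp (g := h) (f := fun a => p + L a) _ ?_ (L.hasFDerivAt.const_add p)
    rw [hp0]
    exact (hh.differentiableAt hn).hasFDerivAt
  have hinr : fderiv ℝ G (0, 0) ∘L .inr ℝ ℝ F = ContinuousLinearMap.id ℝ F := by
    ext w
    simp [hGd.fderiv, hL, hB']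
  have hinl : fderiv ℝ G (0, 0) ∘L .inl ℝ ℝ F = 0 := by
    ext
    simp [hGd.fderiv, hL, hv]
  have hinv : (fderiv ℝ G (0, 0) ∘L .inr ℝ ℝ F).IsInvertible := by
    rw [hinr]
    exact ⟨ContinuousLinearEquiv.refl ℝ F, rfl⟩
  -- `ψ` corrects the line `p + s • v` back to the level set along `B`; its derivative at `0`
  -- vanishes because `v` is in the kernel.
  let ψ := hG.implicitFunction hn hinv
  have hψ0 : ψ 0 = 0 := hG.implicitFunction_apply_self hn hinv
  have hψ : ContDiffAt ℝ n ψ 0 := hG.contDiffAt_implicitFunction hn hinv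
  have hψd : HasFDerivAt ψ (0 : ℝ →L[ℝ] F) 0 := by
    have := (hG.hasStrictFDerivAt_implicitFunction hn hinv).hasFDerivAt
    rw [hinl, ContinuousLinearMap.comp_zero, neg_zero] at this
    exact this
  have hψe : ∀ᶠ s in 𝓝 0, G (s, ψ s) = G (0, 0) := hG.eventually_apply_implicitFunction hn hinv
  refine ⟨fun s => p + L (s, ψ s), by fun_prop, by simp only [hψ0, hp0], ?_, ?_⟩
  · have h1 : HasFDerivAt (fun s : ℝ => p + L (s, ψ s))
        (L ∘L (ContinuousLinearMap.id ℝ ℝ).prod (0 : ℝ →L[ℝ] F)) 0 :=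
      (L.hasFDerivAt.comp (0 : ℝ) ((hasFDerivAt_id (0 : ℝ)).prodMk hψd)).const_add p
    simpa [hL] using h1.hasDerivAt
  · filter_upwards [hψe] with s hs
    simpa only [G, hp0] using hs

theorem IsLocalMin.deriv_deriv_nonneg {f : ℝ → ℝ} {a : ℝ} (h : IsLocalMin f a)
    (hc : ContinuousAt f a) : 0 ≤ deriv (deriv f) a := by
  by_contra! hneg
  have hmax := isLocalMax_of_deriv_deriv_neg hneg h.deriv_eq_zero hc
  have heq : f =ᶠ[𝓝 a] fun _ => f a := by
    filter_upwards [h, hmax] with x h1 h2 using le_antisymm h2 h1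
  have := heq.deriv.deriv_eq
  simp at this
  exact hneg.ne this

/-- Second-order necessary condition for a constrained minimum, for a Lagrangian `g` that is already
critical at `p`. -/
theorem fderiv_fderiv_nonneg_of_isLocalMin_level {h : E → F} {g : E → ℝ} {p : E}
    (hh : ContDiffAt ℝ 2 h p) {B : F →L[ℝ] E}
    (hB : fderiv ℝ h p ∘L B = ContinuousLinearMap.id ℝ F) (hg : ContDiffAt ℝ 2 g p)
    (hcrit : fderiv ℝ g p = 0) (hmin : ∀ᶠ y in 𝓝 p, h y = h p → g p ≤ g y)
    {v : E} (hv : fderiv ℝ h p v = 0) : 0 ≤ fderiv ℝ (fderiv ℝ g) p v v := by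
  obtain ⟨c, hc, rfl, hcv, hce⟩ := exists_contDiffAt_curve_level two_ne_zero hh hB hv
  have hmin' : IsLocalMin (g ∘ c) 0 := by
    filter_upwards [hce, hc.continuousAt.eventually hmin] with s h1 h2 using h2 h1
  have hgc : ContinuousAt (g ∘ c) 0 := hg.continuousAt.comp hc.continuousAt
  have hderiv : deriv (g ∘ c) =ᶠ[𝓝 0] fun s => fderiv ℝ g (c s) (deriv c s) := by
    filter_upwards [hc.eventually (by simp), hc.continuousAt.eventually (hg.eventually (by simp))]
      with s h1 h2
    exact fderiv_comp_deriv s (h2.differentiableAt two_ne_zero) (h1.differentiableAt two_ne_zero)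
  have hc2 : DifferentiableAt ℝ (deriv c) 0 := by
    have : ContDiffAt ℝ 1 (fderiv ℝ c) 0 := hc.fderiv_right (by norm_num)
    exact ((this.differentiableAt one_ne_zero).clm_apply (differentiableAt_const (1 : ℝ)))
  have hg2 : DifferentiableAt ℝ (fderiv ℝ g) (c 0) :=
    (hg.fderiv_right (m := 1) (by norm_num)).differentiableAt one_ne_zero
  have hd : HasDerivAt (fun s => fderiv ℝ g (c s) (deriv c s))
      (fderiv ℝ (fderiv ℝ g) (c 0) v v) 0 := by
    have h1 : HasDerivAt (fun s => fderiv ℝ g (c s)) (fderiv ℝ (fderiv ℝ g) (c 0) v) 0 :=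
      hg2.hasFDerivAt.comp_hasDerivAt 0 hcv
    -- The curve's acceleration enters only through `fderiv ℝ g (c 0)`, which is zero.
    have h2 := h1.clm_apply hc2.hasDerivAt
    rwa [hcrit, hcv.deriv, zero_apply, add_zero] at h2
  rw [← hd.deriv, ← hderiv.deriv_eq]
  exact hmin'.deriv_deriv_nonneg hgc

end

/-! ### The Lagrange system for the squared distance. -/

section
variable {E F : Type*} [NormedAddCommGroup E] [InnerProductSpace ℝ E] [FiniteDimensional ℝ E]
  [NormedAddCommGroup F] [NormedSpace ℝ F] [FiniteDimensional ℝ F]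

/-- The map whose fibre over `(⟪x, ·⟫, 0)` is the set of pairs (point, multiplier) that are critical
for the squared distance to `x` on `{h = 0}`. -/
noncomputable def lagrangeMap (h : E → F) (a : E × (F →L[ℝ] ℝ)) : (E →L[ℝ] ℝ) × F :=
  (innerSL ℝ a.1 + a.2 ∘L fderiv ℝ h a.1, h a.1)

theorem contDiffAt_lagrangeMap {h : E → F} {a : E × (F →L[ℝ] ℝ)} (hh : ContDiffAt ℝ ∞ h a.1) :
    ContDiffAt ℝ ∞ (lagrangeMap h) a := by
  have h1 : ContDiffAt ℝ ∞ (fderiv ℝ h) a.1 := hh.fderiv_right (by simp)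
  have h2 : ContDiffAt ℝ ∞ (fun a : E × (F →L[ℝ] ℝ) => fderiv ℝ h a.1) a :=
    h1.comp a contDiffAt_fst
  have h3 : ContDiffAt ℝ ∞ (fun a : E × (F →L[ℝ] ℝ) => h a.1) a := hh.comp a contDiffAt_fst
  have h4 : ContDiffAt ℝ ∞ (fun a : E × (F →L[ℝ] ℝ) => innerSL ℝ a.1) a :=
    (innerSL ℝ (E := E)).contDiff.contDiffAt.comp a contDiffAt_fst
  exact (h4.add (contDiffAt_snd.clm_comp h2)).prodMk h3

theorem fderiv_lagrangeMap_apply {h : E → F} {p : E} {l : F →L[ℝ] ℝ} (hh : ContDiffAt ℝ ∞ h p)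
    (v : E) (m : F →L[ℝ] ℝ) :
    fderiv ℝ (lagrangeMap h) (p, l) (v, m) =
      (innerSL ℝ v + (l ∘L fderiv ℝ (fderiv ℝ h) p v + m ∘L fderiv ℝ h p), fderiv ℝ h p v) := by
  have h1 : HasFDerivAt (fderiv ℝ h) (fderiv ℝ (fderiv ℝ h) p) p :=
    ((hh.fderiv_right (m := ∞) (by simp)).differentiableAt (by simp)).hasFDerivAt
  have h2 : HasFDerivAt h (fderiv ℝ h p) p := (hh.differentiableAt (by simp)).hasFDerivAt
  have hf : HasFDerivAt (fun a : E × (F →L[ℝ] ℝ) => a.1) (.fst ℝ E (F →L[ℝ] ℝ)) (p, l) :=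
    hasFDerivAt_fst
  have hs : HasFDerivAt (fun a : E × (F →L[ℝ] ℝ) => a.2) (.snd ℝ E (F →L[ℝ] ℝ)) (p, l) :=
    hasFDerivAt_snd
  have h3 := ((innerSL ℝ (E := E)).hasFDerivAt.comp (p, l) hf).add
    (hs.clm_comp (HasFDerivAt.comp (p, l) (g := fderiv ℝ h) h1 hf))
  have h4 := h3.prodMk (HasFDerivAt.comp (p, l) (g := h) h2 hf)
  have h5 : HasFDerivAt (lagrangeMap h) _ (p, l) := h4
  rw [h5.fderiv]
  ext w
  · simp
    rfl
  · simp

/-- The Hessian of the Lagrangian of `½‖y - x'‖²`. -/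
theorem hessian_lagrangian {h : E → F} {p : E} (hh : ContDiffAt ℝ ∞ h p) (x' : E) (l : F →L[ℝ] ℝ) :
    ContDiffAt ℝ ∞ (fun y => (1 / 2 : ℝ) * ‖y - x'‖ ^ 2 + l (h y)) p ∧
    (∀ w, fderiv ℝ (fun y => (1 / 2 : ℝ) * ‖y - x'‖ ^ 2 + l (h y)) p w =
      inner ℝ (p - x') w + l (fderiv ℝ h p w)) ∧
    ∀ v w, fderiv ℝ (fderiv ℝ fun y => (1 / 2 : ℝ) * ‖y - x'‖ ^ 2 + l (h y)) p v w =
      inner ℝ v w + l (fderiv ℝ (fderiv ℝ h) p v w) := by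
  have key : ∀ y, DifferentiableAt ℝ h y →
      HasFDerivAt (fun y => (1 / 2 : ℝ) * ‖y - x'‖ ^ 2 + l (h y))
        (innerSL ℝ (y - x') + l ∘L fderiv ℝ h y) y := by
    intro y hy
    have h1 := ((((hasFDerivAt_id y).sub_const x').norm_sq).const_mul (1 / 2 : ℝ)).add
      (l.hasFDerivAt.comp y hy.hasFDerivAt)
    refine h1.congr_fderiv ?_
    ext w
    simp
  have hd1 : ∀ᶠ y in 𝓝 p, DifferentiableAt ℝ h y := by
    filter_upwards [(hh.of_le (m := 1) (by simp)).eventually (by simp)] with y hy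
      using hy.differentiableAt one_ne_zero
  have heq : fderiv ℝ (fun y => (1 / 2 : ℝ) * ‖y - x'‖ ^ 2 + l (h y)) =ᶠ[𝓝 p]
      fun y => innerSL ℝ (y - x') + l ∘L fderiv ℝ h y := by
    filter_upwards [hd1] with y hy using (key y hy).fderiv
  refine ⟨?_, fun w => ?_, fun v w => ?_⟩
  · have : ContDiffAt ℝ ∞ (fun y => l (h y)) p := l.contDiff.contDiffAt.comp p hh
    exact (contDiffAt_const.mul ((contDiffAt_id.sub contDiffAt_const).norm_sq ℝ)).add this
  · rw [heq.self_of_nhds]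
    rfl
  · have h1 : HasFDerivAt (fderiv ℝ h) (fderiv ℝ (fderiv ℝ h) p) p :=
      ((hh.fderiv_right (m := ∞) (by simp)).differentiableAt (by simp)).hasFDerivAt
    have h2 := ((innerSL ℝ (E := E)).hasFDerivAt.comp p ((hasFDerivAt_id p).sub_const x')).add
      ((hasFDerivAt_const l p).clm_comp h1)
    have h3 : HasFDerivAt (fun y => innerSL ℝ (y - x') + l ∘L fderiv ℝ h y) _ p := h2
    rw [heq.fderiv_eq, h3.fderiv]
    simp
    rfl

/-- If `p` minimizes on `{h = 0}` the distance to a point `p + t (x - p)`, `t > 1`, then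
the critical point equations for the distance to `x` are nondegenerate at `p`. -/
theorem injective_fderiv_lagrangeMap {h : E → F} {p x : E} {l : F →L[ℝ] ℝ}
    (hh : ContDiffAt ℝ ∞ h p) (hsurj : Function.Surjective (fderiv ℝ h p))
    (hl : l ∘L fderiv ℝ h p = innerSL ℝ (x - p)) {t : ℝ} (ht : 1 < t)
    (hmin : ∀ᶠ y in 𝓝 p, h y = h p → ‖p - (p + t • (x - p))‖ ≤ ‖y - (p + t • (x - p))‖) :
    Function.Injective (fderiv ℝ (lagrangeMap h) (p, l)) := by
  obtain ⟨B, hB⟩ := (fderiv ℝ h p).exists_rightInverse_of_surjective (LinearMap.range_eq_top.2 hsurj)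
  rw [injective_iff_map_eq_zero]
  rintro ⟨v, m⟩ hvm
  rw [fderiv_lagrangeMap_apply hh, Prod.mk_eq_zero] at hvm
  obtain ⟨h1, hv⟩ := hvm
  have hlw : ∀ w, l (fderiv ℝ h p w) = inner ℝ (x - p) w := fun w => congr($hl w)
  -- Moving the centre out by the factor `t` scales the multiplier by `t`.
  obtain ⟨g1, g2, g3⟩ := hessian_lagrangian hh (p + t • (x - p)) (t • l)
  have hpos := fderiv_fderiv_nonneg_of_isLocalMin_level (hh.of_le (WithTop.coe_le_coe.2 le_top)) hB
    (g1.of_le (WithTop.coe_le_coe.2 le_top)) (by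
      ext w
      rw [g2]
      simp [hlw, inner_smul_left]) (by
      filter_upwards [hmin] with y hy hyp
      rw [hyp]
      gcongr
      exact hy hyp) hv
  rw [g3, real_inner_self_eq_norm_sq] at hpos
  have hz : ‖v‖ ^ 2 + l (fderiv ℝ (fderiv ℝ h) p v v) = 0 := by
    have := congr($h1 v)
    simpa [hv] using this
  -- Substituting `hz` into `hpos` leaves `(1 - t) * ‖v‖ ^ 2 ≥ 0` with `t > 1`.
  have hv0 : v = 0 := by
    rw [smul_apply, smul_eq_mul] at hpos
    have : ‖v‖ ^ 2 ≤ 0 := by nlinarith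
    simpa using this
  subst hv0
  refine Prod.ext rfl (ContinuousLinearMap.ext fun w => ?_)
  obtain ⟨u, rfl⟩ := hsurj w
  simpa using congr($h1 u)

theorem exists_multiplier {h : E → F} {x y : E} (hh : ContDiffAt ℝ ∞ h y)
    (hsurj : Function.Surjective (fderiv ℝ h y))
    (hmin : ∀ᶠ z in 𝓝 y, h z = h y → ‖y - x‖ ≤ ‖z - x‖) :
    ∃ l : F →L[ℝ] ℝ, l ∘L fderiv ℝ h y = innerSL ℝ (x - y) := by
  have hext : IsLocalExtrOn (fun z => ‖z - x‖ ^ 2) {z | h z = h y} y := by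
    refine Or.inl (eventually_nhdsWithin_iff.2 ?_)
    filter_upwards [hmin] with z hz hzy
    gcongr
    exact hz hzy
  have hd : HasStrictFDerivAt (fun z => ‖z - x‖ ^ 2) ((2 : ℝ) • innerSL ℝ (y - x)) y := by
    have h1 : ContDiffAt ℝ 1 (fun z => ‖z - x‖ ^ 2) y :=
      (contDiffAt_id.sub contDiffAt_const).norm_sq ℝ
    refine h1.hasStrictFDerivAt' ?_ one_ne_zero
    refine (((hasFDerivAt_id y).sub_const x).norm_sq).congr_fderiv ?_
    ext w
    simp [two_smul]
  obtain ⟨L, L0, hne, hL⟩ := hext.exists_linear_map_of_hasStrictFDerivAt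
    (hh.hasStrictFDerivAt (by simp)) hd
  have hL0 : L0 ≠ 0 := by
    rintro rfl
    refine hne (Prod.mk_eq_zero.2 ⟨LinearMap.ext fun w => ?_, rfl⟩)
    obtain ⟨u, rfl⟩ := hsurj w
    simpa using hL u
  refine ⟨(2 * L0)⁻¹ • LinearMap.toContinuousLinearMap L, ?_⟩
  ext w
  have hw := hL w
  simp at hw ⊢
  field_simp
  linarith [hw, inner_sub_left (𝕜 := ℝ) x y w, inner_sub_left (𝕜 := ℝ) y x w]

end

/-! ### Smoothness and differential of the projection. -/

section
variable {E : Type*} [NormedAddCommGroup E] [InnerProductSpace ℝ E] [FiniteDimensional ℝ E]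

theorem finrank_strongDual (V : Type*) [NormedAddCommGroup V] [NormedSpace ℝ V]
    [FiniteDimensional ℝ V] : Module.finrank ℝ (V →L[ℝ] ℝ) = Module.finrank ℝ V :=
  (LinearMap.toContinuousLinearMap (𝕜 := ℝ) (E := V) (F' := ℝ)).finrank_eq.symm.trans
    Subspace.dual_finrank_eq

/-- Lagrange multipliers depend continuously on the constraint differential and the covector. -/
theorem exists_continuousAt_multiplier {F : Type*} [NormedAddCommGroup F] [NormedSpace ℝ F]
    [FiniteDimensional ℝ F] {A₀ : E →L[ℝ] F} (hA₀ : Function.Surjective A₀) :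
    ∃ Λ : (E →L[ℝ] F) × (E →L[ℝ] ℝ) → (F →L[ℝ] ℝ), (∀ k, ContinuousAt Λ (A₀, k)) ∧
      ∀ᶠ A : E →L[ℝ] F in 𝓝 A₀, Function.Surjective A ∧ ∀ l : F →L[ℝ] ℝ, Λ (A, l ∘L A) = l := by
  obtain ⟨B, hB⟩ := A₀.exists_rightInverse_of_surjective (LinearMap.range_eq_top.2 hA₀)
  have hcomp : Continuous fun A : E →L[ℝ] F => A ∘L B := by fun_prop
  have hunit : ∀ᶠ A in 𝓝 A₀, IsUnit (A ∘L B) := by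
    refine hcomp.continuousAt.eventually (Units.isOpen.mem_nhds ?_)
    change IsUnit (A₀ ∘L B)
    rw [hB]
    exact isUnit_one (M := F →L[ℝ] F)
  -- For `k = l ∘L A` this is `l ∘L (A ∘L B) ∘L (A ∘L B)⁻¹ = l`.
  refine ⟨fun a => (a.2 ∘L B) ∘L Ring.inverse (a.1 ∘L B), fun k => ?_, ?_⟩
  · have h1 : ContinuousAt (Ring.inverse (M₀ := F →L[ℝ] F)) (A₀ ∘L B) := by
      rw [hB]
      exact NormedRing.inverse_continuousAt (1 : (F →L[ℝ] F)ˣ)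
    have h2 : ContinuousAt (fun a : (E →L[ℝ] F) × (E →L[ℝ] ℝ) => Ring.inverse (a.1 ∘L B))
        (A₀, k) :=
      ContinuousAt.comp (g := Ring.inverse (M₀ := F →L[ℝ] F)) h1
        (hcomp.continuousAt.comp continuousAt_fst)
    have h3 : Continuous fun a : (E →L[ℝ] F) × (E →L[ℝ] ℝ) => a.2 ∘L B := by fun_prop
    exact h3.continuousAt.clm_comp h2
  · filter_upwards [hunit] with A hA
    have hinv : (A ∘L B) ∘L Ring.inverse (A ∘L B) = ContinuousLinearMap.id ℝ F :=
      Ring.mul_inverse_cancel _ hA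
    refine ⟨fun w => ⟨B (Ring.inverse (A ∘L B) w), congr($hinv w)⟩, fun l => ?_⟩
    ext w
    exact congr(l ($hinv w))

theorem contDiffAt_proj {c : ℕ} {M : Set E} (hne : M.Nonempty) (hc : IsCompact M)
    (hM : IsSmoothSubmanifold c M) {R : ℝ} (hprox : IsProximallySmooth R M) {x : E}
    (hx : infDist x M < R) : ContDiffAt ℝ ∞ (proj M) x := by
  set p := proj M x with hp
  have hpp : p ∈ projSet M x := proj_mem_projSet hne hc x
  obtain ⟨U, hUo, hpU, h, hhU, hsurj, hMU⟩ := hM p hpp.1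
  have hh : ∀ y ∈ U, ContDiffAt ℝ ∞ h y := fun y hy => hhU.contDiffAt (hUo.mem_nhds hy)
  have hzero : ∀ y ∈ U, h y = 0 ↔ y ∈ M := fun y hy =>
    ⟨fun h0 => (hMU.symm ▸ (⟨hy, h0⟩ : y ∈ {y ∈ U | h y = 0}) : y ∈ M ∩ U).1,
      fun hyM => (hMU ▸ (⟨hyM, hy⟩ : y ∈ M ∩ U) : y ∈ {y ∈ U | h y = 0}).2⟩
  have hlocmin : ∀ z y, y ∈ U → y ∈ projSet M z →
      ∀ᶠ w in 𝓝 y, h w = h y → ‖y - z‖ ≤ ‖w - z‖ := by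
    intro z y hyU hy
    filter_upwards [hUo.mem_nhds hyU] with w hwU hw
    refine hy.2 w ((hzero w hwU).1 ?_)
    rw [hw, (hzero y hyU).2 hy.1]
  obtain ⟨l, hl⟩ := exists_multiplier (hh p hpU) hsurj (hlocmin x p hpU hpp)
  obtain ⟨t, ht, htp⟩ := exists_one_lt_mem_projSet hne hc hprox hx hpp
  have hinj := injective_fderiv_lagrangeMap (hh p hpU) hsurj hl ht (hlocmin _ p hpU htp)
  have hfin : Module.finrank ℝ (E × (EuclideanSpace ℝ (Fin c) →L[ℝ] ℝ)) =
      Module.finrank ℝ ((E →L[ℝ] ℝ) × EuclideanSpace ℝ (Fin c)) := by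
    rw [Module.finrank_prod, Module.finrank_prod, finrank_strongDual, finrank_strongDual]
  let e := (LinearEquiv.ofInjectiveOfFinrankEq _ hinj hfin).toContinuousLinearEquiv
  have hLd : ContDiffAt ℝ ∞ (lagrangeMap h) (p, l) := contDiffAt_lagrangeMap (hh p hpU)
  have hLe : HasFDerivAt (lagrangeMap h) (e : _ →L[ℝ] _) (p, l) := by
    refine (hLd.differentiableAt (by simp)).hasFDerivAt.congr_fderiv ?_
    exact ContinuousLinearMap.ext fun a => rfl
  let Ψ := hLd.localInverse hLe (by simp)
  have hval : ∀ z y m, y ∈ U → y ∈ M → m ∘L fderiv ℝ h y = innerSL ℝ (z - y) →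
      lagrangeMap h (y, m) = (innerSL ℝ z, 0) := by
    intro z y m hyU hyM hm
    simp [lagrangeMap, hm, (hzero y hyU).2 hyM]
  have hΨ : ContDiffAt ℝ ∞ Ψ (innerSL ℝ x, 0) := by
    rw [← hval x p l hpU hpp.1 hl]
    exact hLd.to_localInverse hLe (by simp)
  have hleft : ∀ᶠ a in 𝓝 (p, l), Ψ (lagrangeMap h a) = a :=
    (hLd.hasStrictFDerivAt' hLe (by simp)).eventually_left_inverse
  obtain ⟨Λ, hΛc, hΛ⟩ := exists_continuousAt_multiplier hsurj
  have hfd : ContinuousAt (fderiv ℝ h) p :=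
    ((hh p hpU).fderiv_right (m := ∞) (by simp)).continuousAt
  have hproj := tendsto_proj hne hc hprox hx
  rw [← hp] at hproj
  -- The local inverse only recognizes pairs near `(p, l)`, so the multipliers must converge along
  -- with the projections.
  have hΛt : Tendsto (fun z => Λ (fderiv ℝ h (proj M z), innerSL ℝ (z - proj M z))) (𝓝 x) (𝓝 l) := by
    have h1 : Tendsto (fun z => (fderiv ℝ h (proj M z), innerSL ℝ (z - proj M z))) (𝓝 x)
        (𝓝 (fderiv ℝ h p, innerSL ℝ (x - p))) :=
      (hfd.tendsto.comp hproj).prodMk_nhds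
        ((innerSL ℝ (E := E)).continuous.continuousAt.tendsto.comp (tendsto_id.sub hproj))
    have h2 := (hΛc (innerSL ℝ (x - p))).tendsto.comp h1
    rwa [← hl, hΛ.self_of_nhds.2 l] at h2
  have heq : proj M =ᶠ[𝓝 x] fun z => (Ψ (innerSL ℝ z, 0)).1 := by
    filter_upwards [(hproj.prodMk_nhds hΛt).eventually hleft, hproj.eventually (hUo.mem_nhds hpU),
      (hfd.tendsto.comp hproj).eventually hΛ] with z h1 hzU h2
    have hz := proj_mem_projSet hne hc z
    rw [Function.comp_apply] at h2
    obtain ⟨m, hm⟩ := exists_multiplier (hh _ hzU) h2.1 (hlocmin z _ hzU hz)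
    rw [← hm, h2.2 m, hval z _ m hzU hz.1 hm] at h1
    rw [h1]
  refine ContDiffAt.congr_of_eventuallyEq ?_ heq
  have hin : ContDiffAt ℝ ∞ (fun z : E => (innerSL ℝ z, (0 : EuclideanSpace ℝ (Fin c)))) x :=
    (innerSL ℝ (E := E)).contDiff.contDiffAt.prodMk contDiffAt_const
  exact contDiffAt_fst.comp x (ContDiffAt.comp x hΨ hin)

/-- The differential of the projection vanishes on vectors pointing to points whose nearest point
is the base point. -/
theorem fderiv_proj_apply_eq_zero {M : Set E} {R : ℝ} (hR : 0 < R) (hprox : IsProximallySmooth R M)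
    {y p : E} (hp : p ∈ projSet M y) (hd : DifferentiableAt ℝ (proj M) p) :
    fderiv ℝ (proj M) p (y - p) = 0 := by
  have hline : HasDerivAt (fun s : ℝ => p + s • (y - p)) (y - p) 0 := by
    simpa using ((hasDerivAt_id (0 : ℝ)).smul_const (y - p)).const_add p
  have h1 : HasDerivAt (fun s : ℝ => proj M (p + s • (y - p))) (fderiv ℝ (proj M) p (y - p)) 0 := by
    refine HasFDerivAt.comp_hasDerivAt (l := proj M) (0 : ℝ) ?_ hline
    rw [zero_smul, add_zero]
    exact hd.hasFDerivAt
  have hnear : ∀ᶠ s : ℝ in 𝓝 0, infDist (p + s • (y - p)) M < R ∧ s < 1 := by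
    refine Eventually.and ?_ (eventually_lt_nhds one_pos)
    have hcont : Continuous fun s : ℝ => infDist (p + s • (y - p)) M :=
      (continuous_infDist_pt M).comp (by fun_prop)
    refine hcont.continuousAt.eventually (eventually_lt_nhds ?_)
    simpa [infDist_zero_of_mem hp.1] using hR
  -- The projection is known to be constant only for `s ≥ 0`; the one-sided derivative already
  -- determines the value.
  have hev : (fun s : ℝ => proj M (p + s • (y - p))) =ᶠ[𝓝[≥] 0] fun _ => p := by
    filter_upwards [nhdsWithin_le_nhds hnear, self_mem_nhdsWithin] with s hs hs0
    exact proj_eq_of_mem_projSet hprox hs.1 (mem_projSet_segment hp hs0 hs.2.le)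
  have h2 : HasDerivWithinAt (fun s : ℝ => proj M (p + s • (y - p))) 0 (Ici 0) 0 :=
    (hasDerivWithinAt_const (0 : ℝ) (Ici 0) p).congr_of_eventuallyEq_of_mem hev self_mem_Ici
  exact (uniqueDiffWithinAt_Ici 0).eq_deriv _ h1.hasDerivWithinAt h2

/-- First-order Taylor estimate along a segment. -/
theorem norm_sub_sub_fderiv_le_of_segment {f : E → E} {a b : E} {C : ℝ}
    (hf : ∀ y ∈ segment ℝ a b, ContDiffAt ℝ ∞ f y)
    (hC : ∀ y ∈ segment ℝ a b, ‖fderiv ℝ (fderiv ℝ f) y‖ ≤ C) :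
    ‖f b - f a - fderiv ℝ f a (b - a)‖ ≤ C * ‖b - a‖ ^ 2 := by
  have ha := left_mem_segment ℝ a b
  have hb := right_mem_segment ℝ a b
  have hC0 : 0 ≤ C := (norm_nonneg (fderiv ℝ (fderiv ℝ f) a)).trans (hC a ha)
  have hlip : ∀ y ∈ segment ℝ a b, ‖fderiv ℝ f y - fderiv ℝ f a‖ ≤ C * ‖b - a‖ := by
    intro y hy
    refine ((convex_segment a b).norm_image_sub_le_of_norm_fderiv_le (𝕜 := ℝ)
      (fun z hz => ((hf z hz).fderiv_right (m := ∞) (by simp)).differentiableAt (by simp))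
      hC ha hy).trans ?_
    obtain ⟨s, ⟨hs0, hs1⟩, rfl⟩ := (segment_eq_image' ℝ a b ▸ hy : y ∈ _ '' _)
    rw [add_sub_cancel_left, norm_smul, Real.norm_of_nonneg hs0]
    gcongr
    exact mul_le_of_le_one_left (norm_nonneg _) hs1
  -- Using the mean value inequality instead of integrating gives `C` rather than `C / 2`, which is
  -- all the theorem needs.
  have := (convex_segment a b).norm_image_sub_le_of_norm_hasFDerivWithin_le' (𝕜 := ℝ)
    (fun y hy => ((hf y hy).differentiableAt (by simp)).hasFDerivAt.hasFDerivWithinAt) hlip ha hb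
  linarith

end

/-! ### The estimate for the mean. -/

theorem mainTheorem6 {E : Type*} [NormedAddCommGroup E] [InnerProductSpace ℝ E]
    [FiniteDimensional ℝ E] (c : ℕ) (M : Set E) (γ : ℝ)
    (hne : M.Nonempty) (hcompact : IsCompact M) (hM : IsSmoothSubmanifold c M)
    (hγ : 0 < γ) (hprox : IsProximallySmooth (2 * γ) M) :
    (∀ x ∈ closedTube M γ, ContDiffAt ℝ ∞ (proj M) x) ∧
    ∃ M₂ : ℝ,
      IsGreatest (projSecondDerivNorm M '' (convexHull ℝ M ∩ closedTube M γ)) M₂ ∧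
      ∀ (n : ℕ), 0 < n → ∀ (x : PiLp 2 fun _ : Fin n => E) (xbar : E),
        (∀ i, x i ∈ M) →
        xbar ∈ projSet M (euclideanMean x) →
        (∀ i, ‖x i - xbar‖ ≤ γ) →
        ‖xbar - euclideanMean x‖ ≤ M₂ * (‖x - stack n xbar‖ ^ 2 / n) := by
  have hR : 0 < 2 * γ := by positivity
  have hsmooth : ∀ x ∈ closedTube M γ, ContDiffAt ℝ ∞ (proj M) x := fun x hx =>
    contDiffAt_proj hne hcompact hM hprox (lt_of_le_of_lt hx (by linarith))
  have hK : IsCompact (convexHull ℝ M ∩ closedTube M γ) :=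
    (isCompact_convexHull hcompact).inter_right
      (isClosed_le (continuous_infDist_pt M) continuous_const)
  have hKne : (convexHull ℝ M ∩ closedTube M γ).Nonempty := by
    obtain ⟨y, hy⟩ := hne
    exact ⟨y, subset_convexHull ℝ M hy, (infDist_zero_of_mem hy).trans_le hγ.le⟩
  have hcont : ContinuousOn (projSecondDerivNorm M) (convexHull ℝ M ∩ closedTube M γ) := by
    intro x hx
    have h1 : ContDiffAt ℝ ∞ (fderiv ℝ (proj M)) x := (hsmooth x hx.2).fderiv_right (by simp)
    have h2 : ContDiffAt ℝ ∞ (fderiv ℝ (fderiv ℝ (proj M))) x := h1.fderiv_right (by simp)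
    exact (continuous_norm (E := E →L[ℝ] E →L[ℝ] E)).continuousAt.comp_continuousWithinAt
      h2.continuousAt.continuousWithinAt
  obtain ⟨M₂, hM₂⟩ := (hK.image_of_continuousOn hcont).exists_isGreatest (hKne.image _)
  refine ⟨hsmooth, M₂, hM₂, fun n hn x xbar hxM hxbar hxγ => ?_⟩
  have hn' : (n : ℝ) ≠ 0 := by positivity
  have hbarM : xbar ∈ M := hxbar.1
  have hseg : ∀ i, ∀ y ∈ segment ℝ xbar (x i), y ∈ convexHull ℝ M ∩ closedTube M γ := by
    intro i y hy
    refine ⟨segment_subset_convexHull hbarM (hxM i) hy, ?_⟩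
    refine (infDist_le_dist_of_mem hbarM).trans ?_
    have := (convex_closedBall xbar γ).segment_subset (mem_closedBall_self hγ.le)
      (mem_closedBall_iff_norm.2 (hxγ i)) hy
    exact this
  have htaylor : ∀ i, ‖x i - xbar - fderiv ℝ (proj M) xbar (x i - xbar)‖ ≤
      M₂ * ‖x i - xbar‖ ^ 2 := by
    intro i
    have := norm_sub_sub_fderiv_le_of_segment (f := proj M) (a := xbar) (b := x i) (C := M₂)
      (fun y hy => hsmooth y (hseg i y hy).2) fun y hy => hM₂.2 (mem_image_of_mem _ (hseg i y hy))
    rwa [proj_of_mem hR hprox (hxM i), proj_of_mem hR hprox hbarM] at this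
  have hmean : euclideanMean x - xbar = (n : ℝ)⁻¹ • ∑ i, (x i - xbar) := by
    rw [Finset.sum_sub_distrib, smul_sub, euclideanMean]
    simp [← Nat.cast_smul_eq_nsmul ℝ, smul_smul, hn']
  have hnormal : fderiv ℝ (proj M) xbar (euclideanMean x - xbar) = 0 :=
    fderiv_proj_apply_eq_zero hR hprox hxbar
      ((hsmooth xbar ((infDist_zero_of_mem hbarM).trans_le hγ.le)).differentiableAt (by simp))
  have hkey : euclideanMean x - xbar =
      (n : ℝ)⁻¹ • ∑ i, (x i - xbar - fderiv ℝ (proj M) xbar (x i - xbar)) := by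
    rw [Finset.sum_sub_distrib, smul_sub, ← map_sum, ← map_smul, ← hmean, hnormal, sub_zero]
  have hstack : ‖x - stack n xbar‖ ^ 2 = ∑ i, ‖x i - xbar‖ ^ 2 := by
    rw [PiLp.norm_sq_eq_of_L2]
    rfl
  rw [norm_sub_rev, hkey, norm_smul, norm_inv, Real.norm_natCast, hstack, ← mul_div_assoc,
    Finset.mul_sum, inv_mul_eq_div]
  gcongr
  exact norm_sum_le_of_le _ fun i _ => htaylor i
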